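/- For an integer $k\ge 1$, a $k$-step explicit linear multistep method $u_n=\sum_{j=1}^k\alpha_j u_{n-j}+h\sum_{j=1}^k\beta_j f(u_{n-j})$ is given by real coefficients $\alpha_j,\beta_j$ ($1\le j\le k$; zero values are allowed, also for $j=k$). It is of order $p$ if $\sum_{j=1}^k\alpha_j=1$ and $\sum_{j=1}^k\left(j^m\alpha_j-m\,j^{m-1}\beta_j\right)=0$ for $1\le m\le p$. Its SSP coefficient is $\mathcal C=\min\{\alpha_j/\beta_j:\ 1\le j\le k,\ \beta_j\ne0\}$ if all $\alpha_j,\beta_j$ are non-negative, and $\mathcal C=0$ otherwise. For $p\ge1$ let $\mathcal C_{\mathrm{exp}}(k,p)$ be the supremum of $\mathcal C$ over all $k$-step explicit methods of order $p$ ($0$ if there are none). It is non-decreasing in $k$ and at most $1$; put $\mathcal C_{\mathrm{exp}}(\infty,p)=\lim_{k\to\infty}\mathcal C_{\mathrm{exp}}(k,p)$. **Theorem.** Let $p$ be a positive integer. (i) If $p$ is odd, then there is a positive integer $K_p$ such that $\mathcal C_{\mathrm{exp}}(k,p)=\mathcal C_{\mathrm{exp}}(\infty,p)$ for all integers $k\ge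 K_p$. (ii) If $p$ is even, then there is a positive integer $k_p$ such that for all integers $k>k_p$ $$\frac1{k-1}\le \mathcal C_{\mathrm{exp}}(\infty,p-1)-\mathcal C_{\mathrm{exp}}(k,p)\le\frac1{k-k_p}.$$ In particular, $\mathcal C_{\mathrm{exp}}(\infty,p)=\mathcal C_{\mathrm{exp}}(\infty,p-1)$ for even $p$. -/

import Mathlib

open Filter Topology

noncomputable section

/-- Coefficients of a `k`-step explicit linear multistep method
`u_n = ∑_{j=1}^k α_j u_{n-j} + h ∑_{j=1}^k β_j f(u_{n-j})`.
The index `i : Fin k` stands for `j = i + 1`. -/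
structure ExplicitLMM (k : ℕ) where
  α : Fin k → ℝ
  β : Fin k → ℝ

namespace ExplicitLMM

variable {k : ℕ}

/-- Consistency of order `p`: `∑ α_j = 1` and
`∑ (j^m α_j - m j^(m-1) β_j) = 0` for `1 ≤ m ≤ p`. -/
def HasOrder (M : ExplicitLMM k) (p : ℕ) : Prop :=
  ∑ i, M.α i = 1 ∧
    ∀ m : ℕ, 1 ≤ m → m ≤ p →
      ∑ i : Fin k, (((i : ℝ) + 1) ^ m * M.α i - (m : ℝ) * ((i : ℝ) + 1) ^ (m - 1) * M.β i) = 0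

/-- All coefficients are non-negative. -/
def Nonneg (M : ExplicitLMM k) : Prop := ∀ i, 0 ≤ M.α i ∧ 0 ≤ M.β i

open Classical in
/-- The threshold factor (SSP coefficient): `min {α_j / β_j : β_j ≠ 0}` if all coefficients are
non-negative, and `0` otherwise. The minimum is over a finite index set, and this set is
non-empty for a non-negative explicit method of order at least `1`
(see `exists_beta_ne_zero`). -/
def thresholdFactor (M : ExplicitLMM k) : ℝ :=
  if M.Nonneg then ⨅ i : {i : Fin k // M.β i ≠ 0}, M.α i / M.β i else 0

theorem one_le_sum_beta {M : ExplicitLMM k} {p : ℕ} (hp : 1 ≤ p) (hM : M.HasOrder p)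
    (hn : M.Nonneg) : 1 ≤ ∑ i, M.β i := by
  have h1 := hM.2 1 le_rfl hp
  simp only [Finset.sum_sub_distrib] at h1
  have h2 : ∑ i, M.α i ≤ ∑ i : Fin k, ((i : ℝ) + 1) ^ 1 * M.α i := by
    refine Finset.sum_le_sum fun i _ => ?_
    have h3 := (hn i).1
    have h4 : (0 : ℝ) ≤ (i : ℝ) := Nat.cast_nonneg _
    nlinarith [mul_nonneg h4 h3]
  have h5 : ∑ i : Fin k, ((1 : ℕ) : ℝ) * ((i : ℝ) + 1) ^ (1 - 1) * M.β i = ∑ i, M.β i := by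
    simp
  rw [h5] at h1
  rw [hM.1] at h2
  linarith

theorem exists_beta_ne_zero {M : ExplicitLMM k} {p : ℕ} (hp : 1 ≤ p) (hM : M.HasOrder p)
    (hn : M.Nonneg) : ∃ i, M.β i ≠ 0 := by
  by_contra! h
  have := one_le_sum_beta hp hM hn
  simp [h] at this
  linarith

theorem thresholdFactor_nonneg (M : ExplicitLMM k) : 0 ≤ M.thresholdFactor := by
  unfold thresholdFactor
  split_ifs with h
  · exact Real.iInf_nonneg fun i => div_nonneg (h i).1 (h i).2
  · exact le_rfl

theorem thresholdFactor_le_one {M : ExplicitLMM k} {p : ℕ} (hp : 1 ≤ p) (hM : M.HasOrder p) :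
    M.thresholdFactor ≤ 1 := by
  by_cases hn : M.Nonneg
  · have h0 := M.thresholdFactor_nonneg
    have h1 : ∀ i, M.thresholdFactor * M.β i ≤ M.α i := by
      intro i
      by_cases hb : M.β i = 0
      · simpa [hb] using (hn i).1
      · have hpos : 0 < M.β i := lt_of_le_of_ne (hn i).2 (Ne.symm hb)
        rw [← le_div_iff₀ hpos]
        unfold thresholdFactor
        rw [if_pos hn]
        exact ciInf_le (f := fun i : {i : Fin k // M.β i ≠ 0} => M.α i / M.β i)
          (Set.finite_range _).bddBelow ⟨i, hb⟩
    have h2 : M.thresholdFactor * ∑ i, M.β i ≤ 1 := by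
      rw [Finset.mul_sum, ← hM.1]
      exact Finset.sum_le_sum fun i _ => h1 i
    nlinarith [one_le_sum_beta hp hM hn]
  · simp [thresholdFactor, hn]

/-- A `k`-step method seen as a `k+1`-step method. -/
def extend (M : ExplicitLMM k) : ExplicitLMM (k + 1) where
  α := Fin.snoc (α := fun _ => ℝ) M.α 0
  β := Fin.snoc (α := fun _ => ℝ) M.β 0

theorem HasOrder.extend {M : ExplicitLMM k} {p : ℕ} (hM : M.HasOrder p) :
    M.extend.HasOrder p := by
  refine ⟨?_, fun m h1 h2 => ?_⟩
  · simpa [ExplicitLMM.extend, Fin.sum_univ_castSucc] using hM.1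
  · simpa [ExplicitLMM.extend, Fin.sum_univ_castSucc] using hM.2 m h1 h2

theorem thresholdFactor_le_extend {M : ExplicitLMM k} {p : ℕ} (hp : 1 ≤ p)
    (hM : M.HasOrder p) : M.thresholdFactor ≤ M.extend.thresholdFactor := by
  by_cases hn : M.Nonneg
  · have hn' : M.extend.Nonneg := by
      intro i
      refine Fin.lastCases ?_ (fun j => ?_) i
      · simp [extend]
      · simpa [extend] using hn j
    obtain ⟨i0, hi0⟩ := exists_beta_ne_zero hp hM.extend hn'
    have : Nonempty {i : Fin (k + 1) // M.extend.β i ≠ 0} := ⟨⟨i0, hi0⟩⟩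
    unfold thresholdFactor
    rw [if_pos hn, if_pos hn']
    refine le_ciInf ?_
    rintro ⟨i, hi⟩
    revert hi
    refine Fin.lastCases ?_ (fun j => ?_) i
    · intro hi
      simp [extend] at hi
    · intro hi
      have hj : M.β j ≠ 0 := by simpa [extend] using hi
      have := ciInf_le (f := fun i : {i : Fin k // M.β i ≠ 0} => M.α i / M.β i)
          (Set.finite_range _).bddBelow ⟨j, hj⟩
      simpa [extend] using this
  · have : M.thresholdFactor = 0 := by simp [thresholdFactor, hn]
    rw [this]
    exact thresholdFactor_nonneg _

end ExplicitLMM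

/-- The SSP coefficients of all `k`-step explicit methods of order `p`. -/
def sspSet (k p : ℕ) : Set ℝ :=
  {c | ∃ M : ExplicitLMM k, M.HasOrder p ∧ M.thresholdFactor = c}

/-- The optimal SSP coefficient of `k`-step explicit methods of order `p`. The supremum is over a
set of non-negative reals bounded by `1` when `1 ≤ p` (see `bddAbove_sspSet`); it is `0` if there
is no such method. -/
def Cexp (k p : ℕ) : ℝ := sSup (sspSet k p)

/-- `lim_{k → ∞} Cexp k p`; the limit exists when `1 ≤ p`, see `tendsto_Cexp`. -/
def CexpInf (p : ℕ) : ℝ := limUnder atTop (fun k : ℕ => Cexp k p)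

theorem bddAbove_sspSet {k p : ℕ} (hp : 1 ≤ p) : 1 ∈ upperBounds (sspSet k p) := by
  rintro c ⟨M, hM, rfl⟩
  exact M.thresholdFactor_le_one hp hM

theorem monotone_Cexp {p : ℕ} (hp : 1 ≤ p) : Monotone (fun k : ℕ => Cexp k p) := by
  refine monotone_nat_of_le_succ fun k => ?_
  refine Real.sSup_le ?_ (Real.sSup_nonneg ?_)
  · rintro c ⟨M, hM, rfl⟩
    exact (M.thresholdFactor_le_extend hp hM).trans
      (le_csSup ⟨1, bddAbove_sspSet hp⟩ ⟨M.extend, hM.extend, rfl⟩)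
  · rintro c ⟨M, hM, rfl⟩
    exact M.thresholdFactor_nonneg

theorem tendsto_Cexp {p : ℕ} (hp : 1 ≤ p) :
    Tendsto (fun k : ℕ => Cexp k p) atTop (𝓝 (CexpInf p)) := by
  refine tendsto_nhds_limUnder ⟨_, tendsto_atTop_ciSup (monotone_Cexp hp) ⟨1, ?_⟩⟩
  rintro _ ⟨k, rfl⟩
  exact Real.sSup_le (bddAbove_sspSet hp) zero_le_one

end

noncomputable section

open Polynomial

/-! This is linear programming duality followed by a study of linear factors. Order `p` means `∑
(α_j q(j) - β_j q'(j)) = q(0)` for all polynomials `q` of degree at most `p`. Hence `Cexp k p` is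
the least `γ ≥ 0` having a certificate: a nonzero `q` of degree at most `p` with `q(0) ≤ 0`, and
with `q(j) ≥ 0` and `q'(j) ≤ γ q(j)` at the nodes `1, …, k` (`IsCert.Cexp_le`,
`exists_isCert_Cexp`). By compactness, `CexpInf p` has the same description with all positive
integers as nodes.

A root `c` contributes `1/(j - c)` to `q'/q` at `j`. Roots `c ≤ 0` only hurt, which lets one lower
an even degree (`IsCert.exists_natDegree_lt`). A factor `k - X` gains at least `1/(k - 1)`; removing
a root `c ≥ k` costs at most `1/(k - K)` on the nodes up to `K`. These are the two bounds for even
order.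

For odd `p`, take a limit of optimal certificates. If its degree drops, it drops to `p - 2` or less,
contradicting `CexpInf_add_two_lt`. Otherwise the late certificates are valid at all nodes, so the
limit value is attained. -/

/-- A dual certificate for the threshold `γ` on the set of nodes `S`. -/
structure IsCert (q : ℝ[X]) (γ : ℝ) (S : Set ℕ) : Prop where
  ne_zero : q ≠ 0
  eval_zero : q.eval 0 ≤ 0
  nonneg : ∀ j ∈ S, 0 ≤ q.eval (j : ℝ)
  deriv_le : ∀ j ∈ S, q.derivative.eval (j : ℝ) ≤ γ * q.eval (j : ℝ)

/-! ### Perturbing a certificate. -/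

namespace IsCert

theorem mono {q : ℝ[X]} {γ γ' : ℝ} {S T : Set ℕ} (h : IsCert q γ S) (hγ : γ ≤ γ') (hT : T ⊆ S) :
    IsCert q γ' T where
  ne_zero := h.ne_zero
  eval_zero := h.eval_zero
  nonneg j hj := h.nonneg j (hT hj)
  deriv_le j hj := (h.deriv_le j (hT hj)).trans
    (mul_le_mul_of_nonneg_right hγ (h.nonneg j (hT hj)))

/-- Enlarging the threshold, a certificate can be made strictly negative at `0`. -/
theorem exists_strict {q : ℝ[X]} {γ γ' : ℝ} {S : Set ℕ} (h : IsCert q γ' S) (hγ : γ' < γ)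
    (hS : ∀ j ∈ S, 1 ≤ j) :
    ∃ r : ℝ[X], IsCert r γ S ∧ r.natDegree ≤ q.natDegree ∧ r.eval 0 < 0 := by
  obtain ⟨s, hs, hns⟩ := exists_eq_pow_rootMultiplicity_mul_and_not_dvd q h.ne_zero 0
  generalize rootMultiplicity 0 q = m at hs
  have hs0 : s.eval 0 ≠ 0 := fun h0 => hns (dvd_iff_isRoot.2 h0)
  have hsne : s ≠ 0 := by rintro rfl; simp at hs0
  rw [C_0, sub_zero] at hs
  rcases Nat.eq_zero_or_pos m with rfl | hm
  · refine ⟨q, h.mono hγ.le subset_rfl, le_rfl, lt_of_le_of_ne h.eval_zero ?_⟩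
    rw [hs]; simpa using hs0
  have hm' : (0 : ℝ) < m := by exact_mod_cast hm
  -- With `q = X^m s` and `s(0) ≠ 0`, replace `X^m` by `X^m - t`, where `t = ±ε` has the sign of
  -- `s(0)`. The value at `0` becomes `-t s(0) < 0`. At the nodes `j^m - t ≥ 1/2`, so the bound on
  -- `m ε` makes the loss in `q'/q` at most `γ - γ'`.
  obtain ⟨ε, hε0, hε1, hε2⟩ : ∃ ε : ℝ, 0 < ε ∧ ε ≤ 1 / 2 ∧ m * ε ≤ (γ - γ') / 2 := by
    refine ⟨min (1 / 2) ((γ - γ') / (2 * m)), lt_min (by norm_num) ?_, min_le_left _ _, ?_⟩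
    · exact div_pos (by linarith) (by linarith)
    · refine (mul_le_mul_of_nonneg_left (min_le_right _ _) hm'.le).trans (le_of_eq ?_)
      field_simp
  obtain ⟨t, ht, hts⟩ : ∃ t : ℝ, |t| = ε ∧ 0 < t * s.eval 0 := by
    rcases lt_or_gt_of_ne hs0 with h0 | h0
    · exact ⟨-ε, by rw [abs_neg, abs_of_pos hε0], mul_pos_of_neg_of_neg (by linarith) h0⟩
    · exact ⟨ε, abs_of_pos hε0, mul_pos hε0 h0⟩
  have ht1 := (abs_le.1 ht.le).1
  have ht2 := (abs_le.1 ht.le).2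
  have key : ∀ j ∈ S, 0 ≤ s.eval (j : ℝ) ∧ (1 : ℝ) ≤ (j : ℝ) ^ m := by
    intro j hj
    have hj1 : (1 : ℝ) ≤ j := by exact_mod_cast hS j hj
    have hJ : (1 : ℝ) ≤ (j : ℝ) ^ m := one_le_pow₀ hj1
    have := h.nonneg j hj
    rw [hs, eval_mul, eval_pow, eval_X] at this
    exact ⟨nonneg_of_mul_nonneg_right this (by linarith), hJ⟩
  have hev0 : ((X ^ m - C t) * s).eval 0 < 0 := by
    simp only [eval_mul, eval_sub, eval_pow, eval_X, eval_C, zero_pow hm.ne']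
    linarith
  refine ⟨(X ^ m - C t) * s, ⟨?_, hev0.le, ?_, ?_⟩, ?_, hev0⟩
  · intro h0
    rw [h0] at hev0
    simp at hev0
  · intro j hj
    obtain ⟨h1, h2⟩ := key j hj
    simp only [eval_mul, eval_sub, eval_pow, eval_X, eval_C]
    exact mul_nonneg (by linarith) h1
  · intro j hj
    obtain ⟨h1, h2⟩ := key j hj
    have hj1 : (1 : ℝ) ≤ j := by exact_mod_cast hS j hj
    have hd := h.deriv_le j hj
    rw [hs] at hd
    simp only [derivative_mul, derivative_X_pow, eval_add, eval_mul, eval_pow, eval_X,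
      eval_C, derivative_sub, derivative_C, sub_zero, eval_sub, map_natCast, eval_natCast] at hd ⊢
    obtain ⟨n, rfl⟩ : ∃ n, m = n + 1 := ⟨m - 1, by omega⟩
    simp only [Nat.add_sub_cancel] at hd ⊢
    set J := (j : ℝ) ^ (n + 1) with hJ
    set I := (j : ℝ) ^ n
    have hIJ : I ≤ J := pow_le_pow_right₀ hj1 (Nat.le_succ n)
    have hI0 : 0 ≤ I := by positivity
    set a := s.eval (j : ℝ)
    set b := s.derivative.eval (j : ℝ)
    set M : ℝ := ((n + 1 : ℕ) : ℝ)
    have hJ0 : 0 < J := by linarith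
    refine le_of_mul_le_mul_left ?_ hJ0
    have e1 : (J - t) * (M * I * a + J * b) ≤ (J - t) * (γ' * (J * a)) :=
      mul_le_mul_of_nonneg_left hd (by linarith)
    have e2 : M * I * t * a ≤ J * ((γ - γ') / 2) * a := by
      refine mul_le_mul_of_nonneg_right ?_ h1
      calc M * I * t ≤ M * I * ε := mul_le_mul_of_nonneg_left ht2 (by positivity)
        _ = I * (M * ε) := by ring
        _ ≤ J * ((γ - γ') / 2) := mul_le_mul hIJ hε2 (by positivity) hJ0.le
    have e3 : J * ((γ - γ') / 2) * a ≤ J * ((γ - γ') * (J - t)) * a := by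
      refine mul_le_mul_of_nonneg_right (mul_le_mul_of_nonneg_left ?_ hJ0.le) h1
      rw [div_eq_mul_inv]
      exact mul_le_mul_of_nonneg_left (by norm_num; linarith) (by linarith)
    linarith
  · have hdeg : q.natDegree = m + s.natDegree := by
      rw [hs, natDegree_mul (pow_ne_zero _ X_ne_zero) hsne, natDegree_X_pow]
    rw [hdeg]
    refine natDegree_mul_le.trans (Nat.add_le_add_right ?_ _)
    exact (natDegree_X_pow_sub_C).le

end IsCert

/-! ### Weak and strong duality. -/

theorem Polynomial.derivative_eval_eq_sum_range {q : ℝ[X]} {n : ℕ} (hn : q.natDegree < n) (x : ℝ) :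
    q.derivative.eval x = ∑ m ∈ Finset.range n, q.coeff m * (m * x ^ (m - 1)) := by
  conv_lhs => rw [q.as_sum_range' n hn]
  simp [derivative_monomial, eval_finsetSum, mul_assoc]

/-- The order conditions are this identity for the monomials `X^m`, `m ≤ p`; the rest is linearity.
-/
theorem ExplicitLMM.HasOrder.sum_eval {k p : ℕ} {M : ExplicitLMM k} (hM : M.HasOrder p) {q : ℝ[X]}
    (hq : q.natDegree ≤ p) :
    ∑ i : Fin k, (M.α i * q.eval ((i : ℝ) + 1) - M.β i * q.derivative.eval ((i : ℝ) + 1)) =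
      q.eval 0 := by
  have hq' : q.natDegree < p + 1 := by omega
  simp only [derivative_eval_eq_sum_range hq', eval_eq_sum_range' hq', Finset.mul_sum]
  simp only [← Finset.sum_sub_distrib]
  rw [Finset.sum_comm]
  refine Finset.sum_congr rfl fun m hm => ?_
  rcases Nat.eq_zero_or_pos m with rfl | hm0
  · simp [← Finset.sum_mul, hM.1]
  · have := hM.2 m hm0 (by simpa [Nat.lt_succ_iff] using hm)
    rw [zero_pow hm0.ne', mul_zero, ← mul_zero (q.coeff m), ← this, Finset.mul_sum]
    exact Finset.sum_congr rfl fun i _ => by ring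

theorem ExplicitLMM.thresholdFactor_mul_le {k : ℕ} {M : ExplicitLMM k} (hn : M.Nonneg) (i : Fin k) :
    M.thresholdFactor * M.β i ≤ M.α i := by
  by_cases hb : M.β i = 0
  · simpa [hb] using (hn i).1
  · have hpos : 0 < M.β i := lt_of_le_of_ne (hn i).2 (Ne.symm hb)
    rw [← le_div_iff₀ hpos]
    unfold thresholdFactor
    rw [if_pos hn]
    exact ciInf_le (f := fun i : {i : Fin k // M.β i ≠ 0} => M.α i / M.β i)
      (Set.finite_range _).bddBelow ⟨i, hb⟩

/-- Weak duality. If a method had threshold above `γ`, then `α_j q(j) - β_j q'(j) ≥ 0` at every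
node, so `q(0) ≥ 0`. This contradicts `q(0) ≤ 0` only when the latter is strict; the room above `γ`
pays for `IsCert.exists_strict`. -/
theorem IsCert.Cexp_le {q : ℝ[X]} {γ : ℝ} {k p : ℕ} (h : IsCert q γ (Set.Icc 1 k))
    (hq : q.natDegree ≤ p) (hγ : 0 ≤ γ) : Cexp k p ≤ γ := by
  refine Real.sSup_le ?_ hγ
  rintro c ⟨M, hM, rfl⟩
  by_contra! hc
  have hn : M.Nonneg := by
    by_contra hn
    simp only [ExplicitLMM.thresholdFactor, hn, if_false] at hc
    linarith
  obtain ⟨r, hr, hrq, hr0⟩ := h.exists_strict hc fun j hj => hj.1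
  have hsum := hM.sum_eval (hrq.trans hq)
  refine absurd (hsum ▸ hr0) (not_lt.2 (Finset.sum_nonneg fun i _ => ?_))
  have hi : (i : ℕ) + 1 ∈ Set.Icc 1 k := ⟨by omega, i.2⟩
  have h1 := hr.nonneg _ hi
  have h2 := hr.deriv_le _ hi
  push_cast at h1 h2
  have h3 := mul_le_mul_of_nonneg_right (M.thresholdFactor_mul_le hn i) h1
  have h4 := mul_le_mul_of_nonneg_left h2 (hn i).2
  linarith

/-- Gordan's alternative. -/
theorem exists_forall_pos_or_exists_convex_combination {ι : Type*} [Fintype ι] [Nonempty ι] {n : ℕ}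
    (v : ι → Fin n → ℝ) :
    (∃ a : Fin n → ℝ, ∀ i, 0 < ∑ m, a m * v i m) ∨
      ∃ w : ι → ℝ, (∀ i, 0 ≤ w i) ∧ ∑ i, w i = 1 ∧ ∀ m, ∑ i, w i * v i m = 0 := by
  classical
  -- The image of the simplex under `L` is the convex hull of the vectors: it contains `0` or is
  -- strictly separated from it.
  let L : (ι → ℝ) →ₗ[ℝ] (Fin n → ℝ) := Fintype.linearCombination ℝ v
  have hL : Continuous L := L.continuous_of_finiteDimensional
  have hcl : IsClosed (L '' stdSimplex ℝ ι) := ((isCompact_stdSimplex ℝ ι).image hL).isClosed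
  have hcv : Convex ℝ (L '' stdSimplex ℝ ι) := (convex_stdSimplex ℝ ι).linear_image L
  by_cases h0 : (0 : Fin n → ℝ) ∈ L '' stdSimplex ℝ ι
  · right
    obtain ⟨w, hw, hw0⟩ := h0
    refine ⟨w, hw.1, hw.2, fun m => ?_⟩
    have := congrFun hw0 m
    simpa [L, Fintype.linearCombination_apply] using this
  · left
    obtain ⟨f, u, hf0, hf⟩ := geometric_hahn_banach_point_closed hcv hcl h0
    refine ⟨fun m => f (Pi.single m 1), fun i => ?_⟩
    have h1 := hf (v i) ⟨Pi.single i 1, single_mem_stdSimplex ℝ i, by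
      simp [L, Fintype.linearCombination_apply_single]⟩
    have h2 : f (v i) = ∑ m, f (Pi.single m 1) * v i m := by
      conv_lhs => rw [← Finset.univ_sum_single (v i), map_sum]
      refine Finset.sum_congr rfl fun m _ => ?_
      rw [mul_comm, ← smul_eq_mul, ← map_smul, ← Pi.single_smul, smul_eq_mul, mul_one]
    rw [map_zero] at hf0
    linarith

/-- The polynomial with coefficient vector `a`. -/
def coeffPoly {n : ℕ} (a : Fin n → ℝ) : ℝ[X] := ∑ m : Fin n, C (a m) * X ^ (m : ℕ)

theorem coeffPoly_eval {n : ℕ} (a : Fin n → ℝ) (x : ℝ) :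
    (coeffPoly a).eval x = ∑ m, a m * x ^ (m : ℕ) := by
  simp [coeffPoly, eval_finsetSum]

theorem coeffPoly_derivative_eval {n : ℕ} (a : Fin n → ℝ) (x : ℝ) :
    (coeffPoly a).derivative.eval x = ∑ m, a m * ((m : ℕ) * x ^ ((m : ℕ) - 1)) := by
  simp [coeffPoly, eval_finsetSum, derivative_X_pow]

theorem coeffPoly_coeff {n : ℕ} (a : Fin n → ℝ) (m : Fin n) : (coeffPoly a).coeff m = a m := by
  simp [coeffPoly, finsetSum_coeff, coeff_C_mul, coeff_X_pow, Fin.val_inj]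

theorem coeffPoly_coeff_of_le {n : ℕ} (a : Fin n → ℝ) {i : ℕ} (hi : n ≤ i) :
    (coeffPoly a).coeff i = 0 := by
  simp only [coeffPoly, finsetSum_coeff, coeff_C_mul, coeff_X_pow]
  exact Finset.sum_eq_zero fun m _ => by rw [if_neg (by omega), mul_zero]

theorem coeffPoly_natDegree {n : ℕ} (a : Fin (n + 1) → ℝ) : (coeffPoly a).natDegree ≤ n :=
  natDegree_le_iff_coeff_eq_zero.2 fun _ hi => coeffPoly_coeff_of_le a hi

/-- Above the optimal threshold there is a dual certificate. -/
theorem exists_isCert_of_Cexp_lt {k p : ℕ} (hp : 1 ≤ p) {γ : ℝ} (hγ : Cexp k p < γ) :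
    ∃ q : ℝ[X], q.natDegree ≤ p ∧ IsCert q γ (Set.Icc 1 k) := by
  have hC0 : 0 ≤ Cexp k p := Real.sSup_nonneg fun c ⟨M, _, h⟩ => h ▸ M.thresholdFactor_nonneg
  have hγ0 : 0 < γ := hC0.trans_lt hγ
  -- Paired with the coefficients of `q`, these vectors give `-q(0)`, `q(j)` and `γ q(j) - q'(j)`.
  -- So the first alternative is a certificate, and in the second the weights `t, δ, β` yield the
  -- method with coefficients `(δ + γ β)/t` and `β/t`, whose threshold is at least `γ`.
  let v : Option (Fin k ⊕ Fin k) → Fin (p + 1) → ℝ := fun i m =>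
    match i with
    | none => if m = 0 then -1 else 0
    | some (Sum.inl i) => ((i : ℝ) + 1) ^ (m : ℕ)
    | some (Sum.inr i) =>
      γ * ((i : ℝ) + 1) ^ (m : ℕ) - (m : ℕ) * ((i : ℝ) + 1) ^ ((m : ℕ) - 1)
  rcases exists_forall_pos_or_exists_convex_combination v with ⟨a, ha⟩ | ⟨w, hw0, hw1, hw⟩
  · refine ⟨coeffPoly a, coeffPoly_natDegree a, ?_⟩
    have hz : (coeffPoly a).eval 0 < 0 := by
      have := ha none
      rw [coeffPoly_eval]
      simp only [v, mul_ite, mul_neg, mul_one, mul_zero, Finset.sum_ite_eq', Finset.mem_univ,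
        if_true] at this
      rw [Fin.sum_univ_succ]
      simp
      linarith
    have hidx : ∀ j ∈ Set.Icc 1 k, ∃ i : Fin k, (j : ℝ) = (i : ℝ) + 1 := by
      rintro j ⟨h1, h2⟩
      exact ⟨⟨j - 1, by omega⟩, by push_cast [Nat.cast_sub h1]; ring⟩
    refine ⟨?_, hz.le, fun j hj => ?_, fun j hj => ?_⟩
    · intro h
      simp [h] at hz
    · obtain ⟨i, hi⟩ := hidx j hj
      have := ha (some (Sum.inl i))
      rw [hi, coeffPoly_eval]
      exact this.le
    · obtain ⟨i, hi⟩ := hidx j hj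
      have := ha (some (Sum.inr i))
      rw [hi, coeffPoly_eval, coeffPoly_derivative_eval]
      simp only [v, mul_sub, Finset.sum_sub_distrib] at this
      rw [Finset.mul_sum]
      have e : ∀ m : Fin (p + 1), γ * (a m * ((i : ℝ) + 1) ^ (m : ℕ)) =
          a m * (γ * ((i : ℝ) + 1) ^ (m : ℕ)) := fun m => by ring
      simp only [e]
      linarith
  · exfalso
    set t := w none
    set δ : Fin k → ℝ := fun i => w (some (Sum.inl i))
    set β : Fin k → ℝ := fun i => w (some (Sum.inr i))
    have hδ : ∀ i, 0 ≤ δ i := fun i => hw0 _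
    have hβ : ∀ i, 0 ≤ β i := fun i => hw0 _
    have hmom : ∀ m : Fin (p + 1), ∑ i : Fin k, (((i : ℝ) + 1) ^ (m : ℕ) * (δ i + γ * β i) -
        (m : ℕ) * ((i : ℝ) + 1) ^ ((m : ℕ) - 1) * β i) = if m = 0 then t else 0 := by
      intro m
      have h1 := hw m
      rw [Fintype.sum_option, Fintype.sum_sum_type, ← Finset.sum_add_distrib] at h1
      have h2 : ∑ i : Fin k, (((i : ℝ) + 1) ^ (m : ℕ) * (δ i + γ * β i) -
        (m : ℕ) * ((i : ℝ) + 1) ^ ((m : ℕ) - 1) * β i) = ∑ i : Fin k,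
          (w (some (Sum.inl i)) * v (some (Sum.inl i)) m +
            w (some (Sum.inr i)) * v (some (Sum.inr i)) m) :=
        Finset.sum_congr rfl fun i _ => by simp only [v, δ, β]; ring
      rw [h2]
      simp only [v] at h1 ⊢
      split_ifs at h1 ⊢ <;> linarith
    have hm0 : ∑ i : Fin k, (δ i + γ * β i) = t := by simpa using hmom 0
    have hs0 : 0 ≤ ∑ i, δ i := Finset.sum_nonneg fun i _ => hδ i
    have hs1 : 0 ≤ ∑ i, β i := Finset.sum_nonneg fun i _ => hβ i
    rw [Finset.sum_add_distrib, ← Finset.mul_sum] at hm0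
    have htot : t + (∑ i, δ i + ∑ i, β i) = 1 := by
      rw [← hw1, Fintype.sum_option, Fintype.sum_sum_type]
    -- If `t = 0`, the equation for `m = 0` makes all weights vanish, because `γ > 0`.
    have ht : 0 < t := by
      have h1 : 0 ≤ γ * ∑ i, β i := mul_nonneg hγ0.le hs1
      have ht0 : 0 ≤ t := hw0 _
      refine lt_of_le_of_ne ht0 fun h => ?_
      have h2 : γ * ∑ i, β i = 0 := by linarith
      have h3 : ∑ i, β i = 0 := (mul_eq_zero.1 h2).resolve_left hγ0.ne'
      linarith
    let M : ExplicitLMM k := ⟨fun i => (δ i + γ * β i) / t, fun i => β i / t⟩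
    have hM : M.HasOrder p := by
      refine ⟨?_, fun m hm1 hmp => ?_⟩
      · simp only [M]
        rw [← Finset.sum_div, Finset.sum_add_distrib, ← Finset.mul_sum, hm0, div_self ht.ne']
      · have := hmom ⟨m, by omega⟩
        rw [if_neg (by simp [Fin.ext_iff]; omega)] at this
        rw [← zero_div t, ← this, Finset.sum_div]
        exact Finset.sum_congr rfl fun i _ => by simp only [M]; ring
    have hn : M.Nonneg := fun i =>
      ⟨div_nonneg (add_nonneg (hδ i) (mul_nonneg hγ0.le (hβ i))) ht.le, div_nonneg (hβ i) ht.le⟩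
    have hthr : γ ≤ M.thresholdFactor := by
      obtain ⟨i0, hi0⟩ := ExplicitLMM.exists_beta_ne_zero hp hM hn
      have : Nonempty {i : Fin k // M.β i ≠ 0} := ⟨⟨i0, hi0⟩⟩
      unfold ExplicitLMM.thresholdFactor
      rw [if_pos hn]
      refine le_ciInf ?_
      rintro ⟨i, hi⟩
      have hpos : 0 < M.β i := lt_of_le_of_ne (hn i).2 (Ne.symm hi)
      rw [le_div_iff₀ hpos]
      simp only [M]
      rw [← mul_div_assoc]
      exact div_le_div_of_nonneg_right (by linarith [hδ i]) ht.le
    have := le_csSup ⟨1, bddAbove_sspSet hp⟩ (⟨M, hM, rfl⟩ : M.thresholdFactor ∈ sspSet k p)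
    exact absurd hγ (not_lt.2 (hthr.trans this))

/-! ### Compactness: optimal certificates and their limits. -/

theorem IsCert.const_mul {q : ℝ[X]} {γ c : ℝ} {S : Set ℕ} (h : IsCert q γ S) (hc : 0 < c) :
    IsCert (C c * q) γ S where
  ne_zero := mul_ne_zero (C_ne_zero.2 hc.ne') h.ne_zero
  eval_zero := by
    rw [eval_mul, eval_C]
    exact mul_nonpos_of_nonneg_of_nonpos hc.le h.eval_zero
  nonneg j hj := by
    rw [eval_mul, eval_C]
    exact mul_nonneg hc.le (h.nonneg j hj)
  deriv_le j hj := by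
    rw [derivative_C_mul, eval_mul, eval_C, eval_mul, eval_C, mul_left_comm]
    exact mul_le_mul_of_nonneg_left (h.deriv_le j hj) hc.le

/-- A sequence of nonzero polynomials of bounded degree has a subsequence that converges to a
nonzero polynomial after normalization. -/
theorem Polynomial.exists_subseq_tendsto_coeff {p : ℕ} {q : ℕ → ℝ[X]} (hne : ∀ n, q n ≠ 0)
    (hdeg : ∀ n, (q n).natDegree ≤ p) :
    ∃ (c : ℕ → ℝ) (φ : ℕ → ℕ) (Q : ℝ[X]), (∀ n, 0 < c n) ∧ StrictMono φ ∧ Q ≠ 0 ∧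
      Q.natDegree ≤ p ∧
      ∀ i, Tendsto (fun n => (C (c (φ n)) * q (φ n)).coeff i) atTop (𝓝 (Q.coeff i)) := by
  let a : ℕ → Fin (p + 1) → ℝ := fun n m => (q n).coeff m
  have ha : ∀ n, a n ≠ 0 := by
    intro n h
    apply hne n
    ext i
    by_cases hi : i < p + 1
    · exact congrFun h ⟨i, hi⟩
    · exact coeff_eq_zero_of_natDegree_lt (lt_of_le_of_lt (hdeg n) (by omega))
  have hpos : ∀ n, 0 < ‖a n‖⁻¹ := fun n => inv_pos.2 (norm_pos_iff.2 (ha n))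
  obtain ⟨b, hb, φ, hφ, hlim⟩ := (isCompact_sphere (0 : Fin (p + 1) → ℝ) 1).tendsto_subseq
    (x := fun n => ‖a n‖⁻¹ • a n) (fun n => by
      rw [mem_sphere_zero_iff_norm, norm_smul, norm_inv, norm_norm,
        inv_mul_cancel₀ (norm_ne_zero_iff.2 (ha n))])
  refine ⟨fun n => ‖a n‖⁻¹, φ, coeffPoly b, hpos, hφ, ?_, coeffPoly_natDegree b, fun i => ?_⟩
  · intro h
    have : b = 0 := by
      ext m
      rw [← coeffPoly_coeff b m, h, coeff_zero, Pi.zero_apply]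
    rw [this] at hb
    simp at hb
  · by_cases hi : i < p + 1
    · have h1 := (tendsto_pi_nhds.1 hlim) ⟨i, hi⟩
      rw [← coeffPoly_coeff b ⟨i, hi⟩] at h1
      simpa [a, coeff_C_mul] using h1
    · rw [coeffPoly_coeff_of_le b (by omega)]
      refine tendsto_const_nhds.congr fun n => ?_
      rw [coeff_C_mul, coeff_eq_zero_of_natDegree_lt (lt_of_le_of_lt (hdeg _) (by omega)), mul_zero]

theorem Polynomial.tendsto_eval_of_tendsto_coeff {p : ℕ} {r : ℕ → ℝ[X]} {Q : ℝ[X]} {x : ℕ → ℝ}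
    {y : ℝ} (hr : ∀ n, (r n).natDegree ≤ p) (hQ : Q.natDegree ≤ p)
    (h : ∀ i, Tendsto (fun n => (r n).coeff i) atTop (𝓝 (Q.coeff i)))
    (hx : Tendsto x atTop (𝓝 y)) :
    Tendsto (fun n => (r n).eval (x n)) atTop (𝓝 (Q.eval y)) := by
  have e : ∀ n, (r n).eval (x n) = ∑ i ∈ Finset.range (p + 1), (r n).coeff i * x n ^ i := fun n =>
    eval_eq_sum_range' (Nat.lt_succ_of_le (hr n)) _
  rw [eval_eq_sum_range' (Nat.lt_succ_of_le hQ)]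
  simp only [e]
  exact tendsto_finsetSum _ fun i _ => (h i).mul (hx.pow i)

theorem Polynomial.tendsto_derivative_eval_of_tendsto_coeff {p : ℕ} {r : ℕ → ℝ[X]} {Q : ℝ[X]}
    {x : ℕ → ℝ} {y : ℝ} (hr : ∀ n, (r n).natDegree ≤ p) (hQ : Q.natDegree ≤ p)
    (h : ∀ i, Tendsto (fun n => (r n).coeff i) atTop (𝓝 (Q.coeff i)))
    (hx : Tendsto x atTop (𝓝 y)) :
    Tendsto (fun n => (r n).derivative.eval (x n)) atTop (𝓝 (Q.derivative.eval y)) := by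
  refine tendsto_eval_of_tendsto_coeff (p := p)
    (fun n => (natDegree_derivative_le _).trans ((Nat.sub_le _ _).trans (hr n)))
    ((natDegree_derivative_le _).trans ((Nat.sub_le _ _).trans hQ)) (fun i => ?_) hx
  simp only [coeff_derivative]
  exact (h (i + 1)).mul_const _

theorem IsCert.of_tendsto {p : ℕ} {r : ℕ → ℝ[X]} {Q : ℝ[X]} {γ : ℕ → ℝ} {γ' : ℝ} {S : Set ℕ}
    {T : ℕ → Set ℕ} (hcert : ∀ n, IsCert (r n) (γ n) (T n))
    (hr : ∀ n, (r n).natDegree ≤ p) (hQ : Q.natDegree ≤ p) (hQ0 : Q ≠ 0)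
    (h : ∀ i, Tendsto (fun n => (r n).coeff i) atTop (𝓝 (Q.coeff i)))
    (hγ : Tendsto γ atTop (𝓝 γ')) (hT : ∀ j ∈ S, ∀ᶠ n in atTop, j ∈ T n) :
    IsCert Q γ' S := by
  have h1 : ∀ y : ℝ, _ := fun y => tendsto_eval_of_tendsto_coeff hr hQ h (tendsto_const_nhds (x := y))
  have h2 : ∀ y : ℝ, _ := fun y =>
    tendsto_derivative_eval_of_tendsto_coeff hr hQ h (tendsto_const_nhds (x := y))
  refine ⟨hQ0, le_of_tendsto' (h1 0) fun n => (hcert n).eval_zero, fun j hj => ?_, fun j hj => ?_⟩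
  · refine ge_of_tendsto (h1 j) ?_
    filter_upwards [hT j hj] with n hn using (hcert n).nonneg j hn
  · refine le_of_tendsto_of_tendsto (h2 j) (hγ.mul (h1 j)) ?_
    filter_upwards [hT j hj] with n hn using (hcert n).deriv_le j hn

/-- Normalized certificates for thresholds decreasing to `Cexp k p` subconverge, and the defining
inequalities are closed. -/
theorem exists_isCert_Cexp {k p : ℕ} (hp : 1 ≤ p) :
    ∃ q : ℝ[X], q.natDegree ≤ p ∧ IsCert q (Cexp k p) (Set.Icc 1 k) := by
  have hlt : ∀ n : ℕ, Cexp k p < Cexp k p + 1 / ((n : ℝ) + 1) := fun n =>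
    lt_add_of_pos_right _ Nat.one_div_pos_of_nat
  choose q hq hcert using fun n => exists_isCert_of_Cexp_lt hp (hlt n)
  obtain ⟨c, φ, Q, hc, hφ, hQ0, hQ, hlim⟩ :=
    exists_subseq_tendsto_coeff (fun n => (hcert n).ne_zero) hq
  refine ⟨Q, hQ, IsCert.of_tendsto (fun n => (hcert (φ n)).const_mul (hc (φ n)))
    (fun n => (natDegree_C_mul_le _ _).trans (hq _)) hQ hQ0 hlim ?_
    fun j hj => Eventually.of_forall fun _ => hj⟩
  have := (tendsto_one_div_add_atTop_nhds_zero_nat (𝕜 := ℝ)).const_add (Cexp k p)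
  rw [add_zero] at this
  exact this.comp hφ.tendsto_atTop

theorem IsCert.CexpInf_le {q : ℝ[X]} {γ : ℝ} {p : ℕ} (hp : 1 ≤ p) (h : IsCert q γ (Set.Ici 1))
    (hq : q.natDegree ≤ p) (hγ : 0 ≤ γ) : CexpInf p ≤ γ :=
  le_of_tendsto' (tendsto_Cexp hp) fun _ =>
    (h.mono le_rfl Set.Icc_subset_Ici_self).Cexp_le hq hγ

theorem Cexp_le_CexpInf {k p : ℕ} (hp : 1 ≤ p) : Cexp k p ≤ CexpInf p :=
  (monotone_Cexp hp).ge_of_tendsto (tendsto_Cexp hp) k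

theorem Cexp_nonneg (k p : ℕ) : 0 ≤ Cexp k p :=
  Real.sSup_nonneg fun _ ⟨M, _, h⟩ => h ▸ M.thresholdFactor_nonneg

/-- The optimal certificates for `1, …, k` accumulate at an optimal certificate for all nodes. -/
theorem exists_isCert_tendsto {p : ℕ} (hp : 1 ≤ p) :
    ∃ (r : ℕ → ℝ[X]) (φ : ℕ → ℕ) (Q : ℝ[X]), StrictMono φ ∧ (∀ n, (r n).natDegree ≤ p) ∧
      (∀ n, IsCert (r n) (Cexp (φ n) p) (Set.Icc 1 (φ n))) ∧ Q.natDegree ≤ p ∧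
      IsCert Q (CexpInf p) (Set.Ici 1) ∧
      ∀ i, Tendsto (fun n => (r n).coeff i) atTop (𝓝 (Q.coeff i)) := by
  choose q hq hcert using fun k => exists_isCert_Cexp (k := k) hp
  obtain ⟨c, φ, Q, hc, hφ, hQ0, hQ, hlim⟩ :=
    exists_subseq_tendsto_coeff (fun n => (hcert n).ne_zero) hq
  have hr : ∀ n, (C (c (φ n)) * q (φ n)).natDegree ≤ p := fun n =>
    (natDegree_C_mul_le _ _).trans (hq _)
  have hrc := fun n => (hcert (φ n)).const_mul (hc (φ n))
  refine ⟨fun n => C (c (φ n)) * q (φ n), φ, Q, hφ, hr, hrc, hQ, ?_, hlim⟩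
  refine IsCert.of_tendsto hrc hr hQ hQ0 hlim ((tendsto_Cexp hp).comp hφ.tendsto_atTop)
    fun j hj => ?_
  filter_upwards [hφ.tendsto_atTop.eventually_ge_atTop j] with n hn using ⟨hj, hn⟩

/-- Explicit methods of every order with positive threshold factor exist. -/
theorem CexpInf_pos {p : ℕ} (hp : 1 ≤ p) : 0 < CexpInf p := by
  by_contra! h0
  have hC : ∀ k, Cexp k p = 0 := fun k =>
    le_antisymm ((Cexp_le_CexpInf hp).trans h0) (Cexp_nonneg k p)
  -- Rescale the nodes `1, …, n + 1` into `(0, 1]`, where they become dense. With threshold `0`, the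
  -- limit polynomial is non-negative and non-increasing on `(0, 1)` and at most `0` at `0`, hence
  -- zero.
  choose q hq hcert using fun n : ℕ => exists_isCert_Cexp (k := n + 1) hp
  have hN : ∀ n : ℕ, ((n : ℝ) + 1) ≠ 0 := fun n => by positivity
  have hne : ∀ n, (q n).comp (C ((n : ℝ) + 1) * X) ≠ 0 := by
    intro n h
    exact (hcert n).ne_zero 
      (comp_C_mul_X_eq_zero_iff (isUnit_iff_ne_zero.2 (hN n)).mem_nonZeroDivisors |>.1 h)
  have hdeg : ∀ n, ((q n).comp (C ((n : ℝ) + 1) * X)).natDegree ≤ p := by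
    intro n
    rw [natDegree_comp, natDegree_C_mul_X _ (hN n), mul_one]
    exact hq n
  obtain ⟨c, φ, Q, hc, hφ, hQ0, hQ, hlim⟩ := exists_subseq_tendsto_coeff hne hdeg
  have hr : ∀ n, (C (c (φ n)) * (q (φ n)).comp (C ((φ n : ℝ) + 1) * X)).natDegree ≤ p := fun n =>
    (natDegree_C_mul_le _ _).trans (hdeg _)
  have hQz : Q.eval 0 ≤ 0 := by
    refine le_of_tendsto' (tendsto_eval_of_tendsto_coeff hr hQ hlim tendsto_const_nhds) fun n => ?_
    simp only [eval_mul, eval_C, eval_comp, eval_X, mul_zero]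
    exact mul_nonpos_of_nonneg_of_nonpos (hc _).le (hcert _).eval_zero
  have key : ∀ x ∈ Set.Ioo (0 : ℝ) 1, 0 ≤ Q.eval x ∧ Q.derivative.eval x ≤ 0 := by
    intro x hx
    let N : ℕ → ℝ := fun n => (φ n : ℝ) + 1
    have hN0 : ∀ n, 0 < N n := fun n => by positivity
    have hNt : Tendsto N atTop atTop :=
      tendsto_atTop_add_const_right _ _ (tendsto_natCast_atTop_atTop.comp hφ.tendsto_atTop)
    have hx' := (tendsto_nat_ceil_mul_div_atTop hx.1.le).comp hNt
    have hj : ∀ n, ⌈x * N n⌉₊ ∈ Set.Icc 1 (φ n + 1) := by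
      intro n
      refine ⟨Nat.one_le_iff_ne_zero.2 (Nat.ceil_pos.2 (mul_pos hx.1 (hN0 n))).ne', ?_⟩
      rw [Nat.ceil_le]
      push_cast
      exact mul_le_of_le_one_left (hN0 n).le hx.2.le
    have hcancel : ∀ n, N n * ((⌈x * N n⌉₊ : ℝ) / N n) = (⌈x * N n⌉₊ : ℝ) := fun n =>
      mul_div_cancel₀ _ (hN0 n).ne'
    constructor
    · refine ge_of_tendsto' (tendsto_eval_of_tendsto_coeff hr hQ hlim hx') fun n => ?_
      simp only [eval_mul, eval_C, eval_comp, eval_X, Function.comp]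
      rw [hcancel n]
      exact mul_nonneg (hc _).le ((hcert _).nonneg _ (hj n))
    · refine le_of_tendsto' (tendsto_derivative_eval_of_tendsto_coeff hr hQ hlim hx') fun n => ?_
      simp only [derivative_C_mul, derivative_comp, derivative_X, mul_one, eval_mul, eval_C,
        eval_comp, eval_X, Function.comp]
      rw [hcancel n]
      have h1 := (hcert (φ n)).deriv_le _ (hj n)
      rw [hC, zero_mul] at h1
      exact mul_nonpos_of_nonneg_of_nonpos (hc _).le
        (mul_nonpos_of_nonneg_of_nonpos (hN0 n).le h1)
  have hanti : AntitoneOn (fun x => Q.eval x) (Set.Icc (0 : ℝ) 1) := by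
    refine antitoneOn_of_deriv_nonpos (convex_Icc 0 1) Q.continuous.continuousOn
      Q.differentiable.differentiableOn fun x hx => ?_
    rw [interior_Icc] at hx
    rw [Polynomial.deriv]
    exact (key x hx).2
  refine hQ0 (eq_zero_of_infinite_isRoot Q ((Set.Ioo_infinite (zero_lt_one' ℝ)).mono fun x hx => ?_))
  exact le_antisymm ((hanti ⟨le_rfl, zero_le_one⟩ ⟨hx.1.le, hx.2.le⟩ hx.1.le).trans hQz) (key x hx).1

/-! ### Changing the degree of a certificate. -/

/-- In even degree `q(-X)` keeps the leading coefficient; were all its roots negative, it would be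
positive at `0`. -/
theorem Polynomial.exists_nonpos_isRoot {q : ℝ[X]} (h0 : q.eval 0 ≤ 0) (he : Even q.natDegree)
    (hlc : 0 ≤ q.leadingCoeff) : ∃ c ≤ 0, q.IsRoot c := by
  by_contra! h
  have := zero_lt_eval_of_roots_lt_of_leadingCoeff_nonneg (P := q.comp (-X)) (x := 0)
    (fun y hy => by
      by_contra! hy0
      exact h (-y) (by linarith) (by simpa [IsRoot, eval_comp] using hy))
    (by rw [leadingCoeff_comp (by simp)]; simpa [he.neg_one_pow] using hlc)
  simp [eval_comp] at this
  linarith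

/-- Dropping the factor removes the positive term `1/(j - c)` from `q'/q`. The sign of `s(0)` is a
separate hypothesis because it does not follow when `c = 0`. -/
theorem IsCert.of_X_sub_C_mul {s : ℝ[X]} {c γ : ℝ} {S : Set ℕ} (h : IsCert ((X - C c) * s) γ S)
    (hc : c ≤ 0) (hs : s.eval 0 ≤ 0) (hS : ∀ j ∈ S, 1 ≤ j) : IsCert s γ S := by
  have hpos : ∀ j ∈ S, 0 < (j : ℝ) - c := by
    intro j hj
    have : (1 : ℝ) ≤ j := by exact_mod_cast hS j hj
    linarith
  have hnn : ∀ j ∈ S, 0 ≤ s.eval (j : ℝ) := by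
    intro j hj
    have := h.nonneg j hj
    rw [eval_mul, eval_sub, eval_X, eval_C] at this
    exact nonneg_of_mul_nonneg_right this (hpos j hj)
  refine ⟨right_ne_zero_of_mul h.ne_zero, hs, hnn, fun j hj => ?_⟩
  have := h.deriv_le j hj
  simp only [derivative_mul, derivative_sub, derivative_X, derivative_C, sub_zero, one_mul,
    eval_add, eval_mul, eval_sub, eval_X, eval_C] at this
  refine le_of_mul_le_mul_left ?_ (hpos j hj)
  linarith [hnn j hj]

/-- The degree of a certificate of even degree with positive leading coefficient can be lowered. -/
theorem IsCert.exists_natDegree_lt {q : ℝ[X]} {γ : ℝ} {S : Set ℕ} (h : IsCert q γ S)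
    (hS : ∀ j ∈ S, 1 ≤ j) (he : Even q.natDegree) (hlc : 0 ≤ q.leadingCoeff) :
    ∃ s : ℝ[X], s.natDegree < q.natDegree ∧ IsCert s γ S := by
  have hdeg : ∀ (c : ℝ) (s : ℝ[X]), q = (X - C c) * s → q.natDegree = 1 + s.natDegree := by
    intro c s hs
    have hs0 : s ≠ 0 := right_ne_zero_of_mul (hs ▸ h.ne_zero)
    rw [hs, natDegree_mul (X_sub_C_ne_zero c) hs0, natDegree_X_sub_C]
  have hneg : ∀ c < 0, q.IsRoot c → ∃ s : ℝ[X], s.natDegree < q.natDegree ∧ IsCert s γ S := by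
    intro c hc hr
    obtain ⟨s, hs⟩ := dvd_iff_isRoot.2 hr
    refine ⟨s, by have := hdeg c s hs; omega, IsCert.of_X_sub_C_mul (hs ▸ h) hc.le ?_ hS⟩
    have := h.eval_zero
    rw [hs, eval_mul, eval_sub, eval_X, eval_C] at this
    by_contra! h1
    have := mul_pos (show 0 < 0 - c by linarith) h1
    linarith
  obtain ⟨c, hc, hr⟩ := exists_nonpos_isRoot h.eval_zero he hlc
  rcases hc.lt_or_eq with hc | rfl
  · exact hneg c hc hr
  obtain ⟨s, hs⟩ := dvd_iff_isRoot.2 hr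
  have hd := hdeg 0 s hs
  by_cases hs0 : s.eval 0 ≤ 0
  · exact ⟨s, by omega, IsCert.of_X_sub_C_mul (hs ▸ h) le_rfl hs0 hS⟩
  -- The root `0` cannot be removed when `s(0) > 0`. But then `s` has odd degree, hence a strictly
  -- negative root, which can be removed from `q` instead.
  have hodd : Odd s.natDegree := by
    rw [hd] at he
    exact (Nat.even_add'.1 he).1 odd_one
  have hls : s.leadingCoeff = q.leadingCoeff := by
    rw [hs, leadingCoeff_mul, leadingCoeff_X_sub_C, one_mul]
  obtain ⟨y, hy0, hy⟩ : ∃ y, s.IsRoot y ∧ y ≤ 0 := by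
    by_contra! hno
    have := zero_lt_eval_of_roots_lt_of_leadingCoeff_nonneg (P := -(s.comp (-X))) (x := 0)
      (fun y hy => by
        have hy' : s.IsRoot (-y) := by simpa [IsRoot, eval_comp] using hy
        linarith [hno (-y) hy'])
      (by
        rw [leadingCoeff_neg, leadingCoeff_comp (by simp)]
        simpa [hodd.neg_one_pow, hls] using hlc)
    simp [eval_comp] at this
    linarith
  refine hneg y (lt_of_le_of_ne hy ?_) ?_
  · rintro rfl
    exact hs0 hy0.le
  · rw [hs]
    exact root_mul_left_of_isRoot _ hy0

theorem IsCert.leadingCoeff_pos {q : ℝ[X]} {γ : ℝ} (h : IsCert q γ (Set.Ici 1)) :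
    0 < q.leadingCoeff := by
  by_contra! hlc
  rcases hlc.lt_or_eq with hlc | hlc
  · have hd : 0 < q.degree := by
      by_contra! hd
      have hq := eq_C_of_degree_le_zero hd
      have h1 := h.nonneg 1 (Set.mem_Ici.2 le_rfl)
      rw [hq] at h1 hlc
      simp at h1 hlc
      linarith
    have := (tendsto_atBot_of_leadingCoeff_nonpos q hd hlc.le).comp tendsto_natCast_atTop_atTop
    obtain ⟨n, hn, hn1⟩ := ((this.eventually_lt_atBot 0).and (eventually_ge_atTop 1)).exists
    exact absurd (h.nonneg n hn1) (not_le.2 hn)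
  · exact h.ne_zero (leadingCoeff_eq_zero.1 hlc)

theorem Polynomial.eventually_derivative_eval_le {q : ℝ[X]} (hlc : 0 < q.leadingCoeff) {ε : ℝ}
    (hε : 0 < ε) : ∀ᶠ x in atTop, q.derivative.eval x ≤ ε * q.eval x := by
  rcases Nat.eq_zero_or_pos q.natDegree with hd | hd
  · rw [eq_C_of_natDegree_eq_zero hd] at hlc ⊢
    rw [leadingCoeff_C] at hlc
    refine Eventually.of_forall fun x => ?_
    rw [derivative_C, eval_zero, eval_C]
    exact (mul_pos hε hlc).le
  have hdeg : (C ε * q - q.derivative).degree = q.degree := by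
    rw [degree_sub_eq_left_of_degree_lt, degree_C_mul hε.ne']
    rw [degree_C_mul hε.ne']
    exact degree_derivative_lt (by rintro rfl; simp at hd)
  have hl : (C ε * q - q.derivative).leadingCoeff = ε * q.leadingCoeff := by
    rw [leadingCoeff_sub_of_degree_lt, leadingCoeff_mul, leadingCoeff_C]
    rw [degree_C_mul hε.ne']
    exact degree_derivative_lt (by rintro rfl; simp at hd)
  have := tendsto_atTop_of_leadingCoeff_nonneg (C ε * q - q.derivative)
    (by rw [hdeg]; exact natDegree_pos_iff_degree_pos.1 hd) (by rw [hl]; positivity)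
  filter_upwards [this.eventually_ge_atTop 0] with x hx
  simp only [eval_sub, eval_mul, eval_C] at hx
  linarith

/-- Two more orders strictly lower the limiting optimal threshold. -/
theorem CexpInf_add_two_lt {p : ℕ} (hp : 1 ≤ p) : CexpInf (p + 2) < CexpInf p := by
  obtain ⟨-, -, q, -, -, -, hq, hcert, -⟩ := exists_isCert_tendsto hp
  have hγ : 0 < CexpInf p := CexpInf_pos hp
  set γ := CexpInf p
  obtain ⟨a, ha⟩ : ∃ a : ℕ, ∀ j ≥ a, q.derivative.eval (j : ℝ) ≤ γ / 2 * q.eval (j : ℝ) :=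
    eventually_atTop.1 (tendsto_natCast_atTop_atTop.eventually
      (eventually_derivative_eval_le hcert.leadingCoeff_pos (half_pos hγ)))
  -- Multiply `q` by `(X - a)^2 + b^2`, which adds `2u/(u^2 + b^2)` to `q'/q`, where `u = j - a`.
  -- For `j ≥ a` this is at most `1/b = γ/4`, on top of `γ/2`. For `j < a` it is at most `-2/D`,
  -- since `u ≤ -1`. The choice of `η` serves both ranges.
  set b : ℝ := 4 / γ with hb
  have hb0 : 0 < b := by positivity
  have hbγ : b * γ = 4 := by rw [hb]; field_simp
  set D : ℝ := (a : ℝ) ^ 2 + b ^ 2 with hD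
  have hD0 : 0 < D := by positivity
  set η : ℝ := min (γ / 4) (2 / D) with hη
  have hη0 : 0 < η := lt_min (by positivity) (by positivity)
  have hη1 : η ≤ γ / 4 := min_le_left _ _
  have hη2 : η * D ≤ 2 := by
    rw [← le_div_iff₀ hD0]
    exact min_le_right _ _
  have hR : ((X - C (a : ℝ)) ^ 2 + C (b ^ 2)).natDegree = 2 := by
    rw [natDegree_add_C, natDegree_pow, natDegree_X_sub_C]
  have hRne : ((X - C (a : ℝ)) ^ 2 + C (b ^ 2)) ≠ 0 := by
    intro h
    rw [h] at hR
    simp at hR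
  have hQ : IsCert (q * ((X - C (a : ℝ)) ^ 2 + C (b ^ 2))) (γ - η) (Set.Ici 1) := by
    refine ⟨mul_ne_zero hcert.ne_zero hRne, ?_, fun j hj => ?_, fun j hj => ?_⟩
    · simp only [eval_mul, eval_add, eval_pow, eval_sub, eval_X, eval_C]
      exact mul_nonpos_of_nonpos_of_nonneg hcert.eval_zero (by positivity)
    · simp only [eval_mul, eval_add, eval_pow, eval_sub, eval_X, eval_C]
      exact mul_nonneg (hcert.nonneg j hj) (by positivity)
    · have h1 := hcert.nonneg j hj
      have h2 := hcert.deriv_le j hj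
      simp only [derivative_mul, derivative_add, derivative_X_sub_C_sq, derivative_C, add_zero,
        eval_mul, eval_add, eval_pow, eval_sub, eval_X, eval_C]
      set y := q.eval (j : ℝ)
      set z := q.derivative.eval (j : ℝ)
      set u : ℝ := (j : ℝ) - a with hu
      have hw : 0 < u ^ 2 + b ^ 2 := by positivity
      rcases lt_or_ge j a with hja | hja
      · have hu1 : u ≤ -1 := by
          have : (j : ℝ) + 1 ≤ a := by exact_mod_cast hja
          linarith
        have hu2 : u ^ 2 + b ^ 2 ≤ D := by
          have hj0 : (0 : ℝ) ≤ j := j.cast_nonneg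
          have : u ^ 2 ≤ (a : ℝ) ^ 2 := by
            rw [← neg_sq u]
            exact pow_le_pow_left₀ (by linarith) (by linarith) 2
          linarith
        have h3 : η * (u ^ 2 + b ^ 2) ≤ 2 := (mul_le_mul_of_nonneg_left hu2 hη0.le).trans hη2
        have h4 := mul_le_mul_of_nonneg_right h2 hw.le
        have h5 : y * (2 * u + η * (u ^ 2 + b ^ 2)) ≤ 0 :=
          mul_nonpos_of_nonneg_of_nonpos h1 (by linarith)
        linarith
      · have h3 := mul_le_mul_of_nonneg_right (ha j hja) hw.le
        have h4 : 2 * u ≤ γ / 4 * (u ^ 2 + b ^ 2) := by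
          have : 2 * u * b ≤ u ^ 2 + b ^ 2 := two_mul_le_add_sq u b
          have h6 := mul_le_mul_of_nonneg_left this (show 0 ≤ γ / 4 by positivity)
          linear_combination h6 - (1 / 2) * u * hbγ
        have h5 := mul_le_mul_of_nonneg_left h4 h1
        have h6 := mul_nonneg h1 (mul_nonneg (sub_nonneg.2 hη1) hw.le)
        linarith
  have := hQ.CexpInf_le (p := p + 2) (by omega)
    (natDegree_mul_le.trans (by rw [hR]; omega)) (by linarith)
  linarith

/-! ### Odd order: the limit is attained. -/

/-- A uniform bound beyond which polynomials with bounded coefficients and leading coefficient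
bounded from below are non-negative. -/
theorem Polynomial.eval_nonneg_of_coeff_bounds {f : ℝ[X]} {p : ℕ} {l B x : ℝ}
    (hf : f.natDegree ≤ p) (hl : l ≤ f.coeff p) (hB : ∀ i < p, |f.coeff i| ≤ B) (hx : 1 ≤ x)
    (hxl : p * B ≤ l * x) : 0 ≤ f.eval x := by
  rw [eval_eq_sum_range' (Nat.lt_succ_of_le hf), Finset.sum_range_succ]
  rcases Nat.eq_zero_or_pos p with rfl | hp
  · simp at hxl ⊢
    have : 0 ≤ l := nonneg_of_mul_nonneg_left hxl (by linarith)
    linarith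
  have h1 : ∀ i ∈ Finset.range p, -(B * x ^ (p - 1)) ≤ f.coeff i * x ^ i := by
    intro i hi
    have hi' := Finset.mem_range.1 hi
    have h2 : |f.coeff i * x ^ i| ≤ B * x ^ (p - 1) := by
      rw [abs_mul, abs_of_nonneg (by positivity : 0 ≤ x ^ i)]
      exact mul_le_mul (hB i hi') (pow_le_pow_right₀ hx (by omega)) (by positivity)
        ((abs_nonneg _).trans (hB i hi'))
    exact (abs_le.1 h2).1
  have h2 := Finset.sum_le_sum h1
  rw [Finset.sum_const, Finset.card_range, nsmul_eq_mul] at h2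
  have h3 : l * x ^ p ≤ f.coeff p * x ^ p := mul_le_mul_of_nonneg_right hl (by positivity)
  have h4 : p * B * x ^ (p - 1) ≤ l * x * x ^ (p - 1) :=
    mul_le_mul_of_nonneg_right hxl (by positivity)
  have h5 : l * x * x ^ (p - 1) = l * x ^ p := by
    rw [mul_assoc, ← pow_succ', Nat.sub_add_cancel hp]
  linarith

/-- One half-line serves all late `n`, because coefficient `p` stays away from `0`. This extends
certificates from the nodes `1, …, k` to all nodes. -/
theorem Polynomial.exists_forall_eval_nonneg_of_tendsto_coeff {r : ℕ → ℝ[X]} {Q : ℝ[X]} {p : ℕ}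
    (hr : ∀ n, (r n).natDegree ≤ p) (hQ : 0 < Q.coeff p)
    (h : ∀ i, Tendsto (fun n => (r n).coeff i) atTop (𝓝 (Q.coeff i))) :
    ∃ R : ℝ, ∀ᶠ n in atTop, ∀ x ≥ R, 0 ≤ (r n).eval x := by
  set B : ℝ := ∑ i ∈ Finset.range p, (|Q.coeff i| + 1)
  have h1 : ∀ᶠ n in atTop, Q.coeff p / 2 < (r n).coeff p :=
    (h p).eventually_const_lt (half_lt_self hQ)
  have h2 : ∀ᶠ n in atTop, ∀ i ∈ Finset.range p, |(r n).coeff i| ≤ B := by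
    refine (Finset.eventually_all _).2 fun i hi => ?_
    filter_upwards [(h i).abs.eventually_lt_const (lt_add_one |Q.coeff i|)] with n hn
    exact hn.le.trans (Finset.single_le_sum (f := fun i => |Q.coeff i| + 1)
      (fun i _ => by positivity) hi)
  refine ⟨max 1 (p * B / (Q.coeff p / 2)), ?_⟩
  filter_upwards [h1, h2] with n hn1 hn2 x hx
  refine eval_nonneg_of_coeff_bounds (hr n) hn1.le (fun i hi => hn2 i (Finset.mem_range.2 hi))
    ((le_max_left _ _).trans hx) ?_
  have := (le_max_right _ _).trans hx
  rw [div_le_iff₀ (half_pos hQ)] at this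
  linarith

/-- For odd order, the optimal threshold is attained with finitely many steps. -/
theorem exists_Cexp_eq_CexpInf {p : ℕ} (hp : Odd p) :
    ∃ K : ℕ, 1 ≤ K ∧ ∀ k : ℕ, K ≤ k → Cexp k p = CexpInf p := by
  have hp1 : 1 ≤ p := hp.pos
  suffices h : ∃ k, CexpInf p ≤ Cexp k p by
    obtain ⟨K, hK⟩ := h
    exact ⟨max 1 K, le_max_left _ _, fun k hk => le_antisymm (Cexp_le_CexpInf hp1)
      (hK.trans (monotone_Cexp hp1 ((le_max_right _ _).trans hk)))⟩
  by_contra! hlt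
  have hpos := CexpInf_pos hp1
  obtain ⟨r, φ, Q, hφ, hr, hrc, hQ, hQc, hlim⟩ := exists_isCert_tendsto hp1
  have hlc := hQc.leadingCoeff_pos
  rcases hQ.lt_or_eq with hQp | hQp
  -- Degree `p - 1` is even, so it can be lowered. The last conjunct excludes `p = 1`, where `p - 2`
  -- truncates.
  · obtain ⟨s, hs, hsc⟩ : ∃ s : ℝ[X], s.natDegree ≤ p - 2 ∧ IsCert s (CexpInf p) (Set.Ici 1) ∧
        s.natDegree < p - 1 := by
      rcases (Nat.le_sub_one_of_lt hQp).lt_or_eq with hQ1 | hQ1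
      · exact ⟨Q, by omega, hQc, hQ1⟩
      · have hev : Even Q.natDegree := by
          rw [hQ1]
          exact hp.tsub_odd odd_one
        obtain ⟨s, hs, hsc⟩ := hQc.exists_natDegree_lt (fun _ hj => hj) hev hlc.le
        exact ⟨s, by omega, hsc, by omega⟩
    obtain ⟨m, rfl⟩ := hp
    have hm : 1 ≤ 2 * m + 1 - 2 := by omega
    have h1 := hsc.1.CexpInf_le hm hs hpos.le
    have h2 := CexpInf_add_two_lt hm
    rw [show 2 * m + 1 - 2 + 2 = 2 * m + 1 by omega] at h2
    linarith
  · have hQcoeff : 0 < Q.coeff p := by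
      rw [← hQp]
      exact hlc
    -- The thresholds `Cexp (φ n) p` vary with `n` but eventually exceed `ε`, so beyond the last
    -- node `q' ≤ ε q` suffices.
    set ε := CexpInf p / 2 with hε
    have hε0 : 0 < ε := half_pos hpos
    obtain ⟨R₁, hR₁⟩ := exists_forall_eval_nonneg_of_tendsto_coeff hr hQcoeff hlim
    obtain ⟨R₂, hR₂⟩ := exists_forall_eval_nonneg_of_tendsto_coeff (p := p)
      (r := fun n => C ε * r n - (r n).derivative) (Q := C ε * Q - Q.derivative)
      (fun n => (natDegree_sub_le_of_le ((natDegree_C_mul_le _ _).trans (hr n))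
        ((natDegree_derivative_le _).trans ((Nat.sub_le _ _).trans (hr n)))).trans (max_self p).le)
      (by
        rw [coeff_sub, coeff_C_mul, coeff_derivative,
          coeff_eq_zero_of_natDegree_lt (by omega : Q.natDegree < p + 1), zero_mul, sub_zero]
        positivity)
      (fun i => by
        simp only [coeff_sub, coeff_C_mul, coeff_derivative]
        exact ((hlim i).const_mul _).sub ((hlim (i + 1)).mul_const _))
    have hCε : ∀ᶠ n in atTop, ε < Cexp (φ n) p :=
      ((tendsto_Cexp hp1).comp hφ.tendsto_atTop).eventually_const_lt (half_lt_self hpos)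
    have hφR : ∀ᶠ n in atTop, max R₁ R₂ ≤ (φ n : ℝ) :=
      (tendsto_natCast_atTop_atTop.comp hφ.tendsto_atTop).eventually_ge_atTop _
    obtain ⟨n, h1, h2, h3, h4⟩ := (hR₁.and (hR₂.and (hCε.and hφR))).exists
    have hfull : IsCert (r n) (Cexp (φ n) p) (Set.Ici 1) := by
      have hbig : ∀ j : ℕ, φ n < j → max R₁ R₂ ≤ (j : ℝ) := fun j hj =>
        h4.trans (by exact_mod_cast hj.le)
      refine ⟨(hrc n).ne_zero, (hrc n).eval_zero, fun j hj => ?_, fun j hj => ?_⟩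
      · rcases le_or_gt j (φ n) with hjn | hjn
        · exact (hrc n).nonneg j ⟨hj, hjn⟩
        · exact h1 j ((le_max_left _ _).trans (hbig j hjn))
      · rcases le_or_gt j (φ n) with hjn | hjn
        · exact (hrc n).deriv_le j ⟨hj, hjn⟩
        · have h5 := h1 j ((le_max_left _ _).trans (hbig j hjn))
          have h6 := h2 j ((le_max_right _ _).trans (hbig j hjn))
          simp only [eval_sub, eval_mul, eval_C] at h6
          have h7 := mul_le_mul_of_nonneg_right h3.le h5
          linarith
    exact absurd (hfull.CexpInf_le hp1 (hr n) (Cexp_nonneg _ _)) (not_le.2 (hlt _))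

/-! ### Even order: the two bounds. -/

/-- Raising the order costs at least `1 / (k - 1)`. -/
theorem Cexp_succ_le {k p : ℕ} (hp : 1 ≤ p) (hk : 2 ≤ k) (h : 1 / ((k : ℝ) - 1) ≤ CexpInf p) :
    Cexp k (p + 1) ≤ CexpInf p - 1 / ((k : ℝ) - 1) := by
  obtain ⟨-, -, q, -, -, -, hq, hcert, -⟩ := exists_isCert_tendsto hp
  have hk1 : (0 : ℝ) < (k : ℝ) - 1 := by
    have : (2 : ℝ) ≤ k := by exact_mod_cast hk
    linarith
  -- The factor `k - X` is non-negative at the nodes and contributes `-1/(k - j) ≤ -1/(k - 1)` to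
  -- `q'/q` for `j < k`; at `j = k` the product vanishes and its derivative is `-q(k) ≤ 0`.
  have hQ : IsCert (q * (C (k : ℝ) - X)) (CexpInf p - 1 / ((k : ℝ) - 1)) (Set.Icc 1 k) := by
    refine ⟨mul_ne_zero hcert.ne_zero fun h0 => ?_, ?_, fun j hj => ?_, fun j hj => ?_⟩
    · have := congrArg (eval 1) h0
      simp at this
      linarith
    · simp only [eval_mul, eval_sub, eval_X, eval_C]
      exact mul_nonpos_of_nonpos_of_nonneg hcert.eval_zero (by simp)
    all_goals
      have h1 := hcert.nonneg j hj.1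
      have hjk : (0 : ℝ) ≤ (k : ℝ) - j := sub_nonneg.2 (by exact_mod_cast hj.2)
      have hj1 : (1 : ℝ) ≤ j := by exact_mod_cast hj.1
    · simp only [eval_mul, eval_sub, eval_X, eval_C]
      exact mul_nonneg h1 hjk
    · have h2 := mul_le_mul_of_nonneg_right (hcert.deriv_le j hj.1) hjk
      simp only [derivative_mul, derivative_sub, derivative_X, derivative_C, eval_add, zero_sub,
        eval_mul, eval_sub, eval_X, eval_C, eval_neg, eval_one]
      have h3 : 1 / ((k : ℝ) - 1) * ((k : ℝ) - j) ≤ 1 := by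
        rw [one_div_mul_eq_div, div_le_one hk1]
        linarith
      have h4 := mul_le_mul_of_nonneg_left h3 h1
      linarith
  refine hQ.Cexp_le (natDegree_mul_le.trans (Nat.add_le_add hq ?_)) (by linarith)
  exact (natDegree_sub_le _ _).trans (by simp)

/-- Raising the order from odd to even costs at most `1 / (k - K)` compared with `K` steps. -/
theorem Cexp_le_Cexp_succ_add {k K p : ℕ} (hp : Odd p) (hK : K < k) :
    Cexp K p ≤ Cexp k (p + 1) + 1 / ((k : ℝ) - K) := by
  have hKk : (0 : ℝ) < (k : ℝ) - K := sub_pos.2 (by exact_mod_cast hK)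
  obtain ⟨q, hq, hcert⟩ := exists_isCert_Cexp (k := k) (p := p + 1) (by omega)
  have hC := Cexp_nonneg k (p + 1)
  have hlow : ∀ s : ℝ[X], s.natDegree ≤ p → IsCert s (Cexp k (p + 1)) (Set.Icc 1 k) →
      Cexp K p ≤ Cexp k (p + 1) + 1 / ((k : ℝ) - K) := by
    intro s hs hsc
    have h1 := (hsc.mono le_rfl (Set.Icc_subset_Icc_right hK.le)).Cexp_le hs hC
    have : 0 < 1 / ((k : ℝ) - K) := by positivity
    linarith
  rcases hq.lt_or_eq with hqp | hqp
  · exact hlow q (by omega) hcert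
  rcases le_or_gt 0 q.leadingCoeff with hlc | hlc
  · obtain ⟨s, hs, hsc⟩ := hcert.exists_natDegree_lt (fun _ hj => hj.1)
      (by rw [hqp]; exact hp.add_one) hlc
    exact hlow s (by omega) hsc
  -- A negative leading coefficient with `q(k) ≥ 0` forces a root `c ≥ k`. Dividing by `c - X`
  -- raises `q'/q` by `1/(c - j)`, at most `1/(k - K)` on the nodes up to `K`.
  obtain ⟨c, hr, hc⟩ : ∃ c, q.IsRoot c ∧ (k : ℝ) ≤ c := by
    by_contra! hno
    have := zero_lt_eval_of_roots_lt_of_leadingCoeff_nonneg (P := -q) (x := k)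
      (fun y hy => hno y (by simpa [IsRoot] using hy))
      (by rw [leadingCoeff_neg]; linarith)
    have h2 := hcert.nonneg k ⟨by omega, le_rfl⟩
    simp at this
    linarith
  obtain ⟨t, ht⟩ := dvd_iff_isRoot.2 hr
  have hk0 : (0 : ℝ) < k := by exact_mod_cast (Nat.zero_le K).trans_lt hK
  have ht0 : t ≠ 0 := right_ne_zero_of_mul (ht ▸ hcert.ne_zero)
  have hdeg : q.natDegree = 1 + t.natDegree := by
    rw [ht, natDegree_mul (X_sub_C_ne_zero c) ht0, natDegree_X_sub_C]
  have hgap : ∀ j ∈ Set.Icc 1 K, (k : ℝ) - K ≤ c - j := by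
    intro j hj
    have : (j : ℝ) ≤ K := by exact_mod_cast hj.2
    linarith
  have hnn : ∀ j ∈ Set.Icc 1 K, 0 ≤ -t.eval (j : ℝ) := by
    intro j hj
    have h1 := hcert.nonneg j ⟨hj.1, hj.2.trans hK.le⟩
    rw [ht, eval_mul, eval_sub, eval_X, eval_C] at h1
    refine nonneg_of_mul_nonneg_right (b := -t.eval (j : ℝ)) (a := c - j) ?_
      (hKk.trans_le (hgap j hj))
    linarith
  have hs : IsCert (-t) (Cexp k (p + 1) + 1 / ((k : ℝ) - K)) (Set.Icc 1 K) := by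
    refine ⟨neg_ne_zero.2 ht0, ?_, fun j hj => ?_, fun j hj => ?_⟩
    · have h1 := hcert.eval_zero
      rw [ht, eval_mul, eval_sub, eval_X, eval_C] at h1
      rw [eval_neg]
      by_contra! h2
      have := mul_pos (hk0.trans_le hc) h2
      linarith
    · rw [eval_neg]
      exact hnn j hj
    · have h1 := hcert.deriv_le j ⟨hj.1, hj.2.trans hK.le⟩
      have h2 := hnn j hj
      have hg := hgap j hj
      simp only [ht, derivative_mul, derivative_sub, derivative_X, derivative_C, sub_zero, one_mul,
        eval_add, eval_mul, eval_sub, eval_X, eval_C, derivative_neg, eval_neg] at h1 ⊢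
      refine le_of_mul_le_mul_left ?_ (hKk.trans_le hg)
      have h3 : 1 ≤ 1 / ((k : ℝ) - K) * (c - j) := by
        rw [one_div_mul_eq_div, one_le_div hKk]
        exact hg
      have h4 := mul_le_mul_of_nonneg_right h3 h2
      linarith
  exact hs.Cexp_le (by rw [natDegree_neg]; omega) (by positivity)

theorem mainTheorem4 (p : ℕ) (hp : 1 ≤ p) :
    (Odd p → ∃ K : ℕ, 1 ≤ K ∧ ∀ k : ℕ, K ≤ k → Cexp k p = CexpInf p) ∧
    (Even p →
      (∃ kp : ℕ, 1 ≤ kp ∧ ∀ k : ℕ, kp < k →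
        1 / ((k : ℝ) - 1) ≤ CexpInf (p - 1) - Cexp k p ∧
        CexpInf (p - 1) - Cexp k p ≤ 1 / ((k : ℝ) - (kp : ℝ))) ∧
      CexpInf p = CexpInf (p - 1)) := by
  refine ⟨exists_Cexp_eq_CexpInf, fun he => ?_⟩
  obtain ⟨d, rfl⟩ : ∃ d, p = d + 1 := ⟨p - 1, by omega⟩
  have hd : Odd d := by
    by_contra h
    exact (Nat.even_add_one.1 he) (Nat.not_odd_iff_even.1 h)
  rw [Nat.add_sub_cancel]
  have hbounds : ∃ kp : ℕ, 1 ≤ kp ∧ ∀ k : ℕ, kp < k →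
      1 / ((k : ℝ) - 1) ≤ CexpInf d - Cexp k (d + 1) ∧
      CexpInf d - Cexp k (d + 1) ≤ 1 / ((k : ℝ) - (kp : ℝ)) := by
    obtain ⟨K, hK1, hK⟩ := exists_Cexp_eq_CexpInf hd
    -- For `k > N`, `1/(k - 1)` is at most `CexpInf d`, as `Cexp_succ_le` requires.
    obtain ⟨N, hN⟩ := exists_nat_gt (1 / CexpInf d)
    have hpos := CexpInf_pos hd.pos
    refine ⟨max K N, hK1.trans (le_max_left _ _), fun k hk => ⟨?_, ?_⟩⟩
    · have hNk : (N : ℝ) ≤ (k : ℝ) - 1 := by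
        have : (N : ℝ) + 1 ≤ k := by exact_mod_cast (le_max_right K N).trans_lt hk
        linarith
      have h1 : 1 / ((k : ℝ) - 1) ≤ CexpInf d := by
        rw [one_div_le ((one_div_pos.2 hpos).trans (hN.trans_le hNk)) hpos]
        exact hN.le.trans hNk
      have hk2 : 2 ≤ k := (Nat.succ_le_succ (hK1.trans (le_max_left K N))).trans hk
      linarith [Cexp_succ_le hd.pos hk2 h1]
    · have := Cexp_le_Cexp_succ_add hd hk
      rw [hK _ (le_max_left K N)] at this
      linarith
  refine ⟨hbounds, ?_⟩
  obtain ⟨kp, -, hkp⟩ := hbounds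
  have hlim : Tendsto (fun k : ℕ => CexpInf d - Cexp k (d + 1)) atTop
      (𝓝 (CexpInf d - CexpInf (d + 1))) := (tendsto_Cexp hp).const_sub _
  have hz : ∀ c : ℝ, Tendsto (fun k : ℕ => 1 / ((k : ℝ) - c)) atTop (𝓝 0) := fun c =>
    tendsto_const_nhds.div_atTop
      (tendsto_atTop_add_const_right _ (-c) tendsto_natCast_atTop_atTop)
  have h0 := tendsto_of_tendsto_of_tendsto_of_le_of_le' (hz 1) (hz kp)
    ((eventually_gt_atTop kp).mono fun k hk => (hkp k hk).1)
    ((eventually_gt_atTop kp).mono fun k hk => (hkp k hk).2)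
  linarith [tendsto_nhds_unique hlim h0]

end
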